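/- **Setting.** Fix a set $P$ of propositional variables. *Logics.* - $\mathsf{CL}$ is classical propositional logic in the language $p,\neg,\wedge,\vee,\to$, given by Gentzen's sequent calculus with cut, exchange, contraction and weakening, and with both the multiplicative and the additive rules for the connectives. - $\mathsf{ALL}$ is additive linear logic in the language $p,\neg,\&,\oplus,\leadsto$ (no constants). It is given by the two-sided sequent calculus on multisets whose rules are identity, cut, the negation rules and the additive rules for $\&,\oplus,\leadsto$ (where $A\leadsto B$ behaves as $\neg A\oplus B$), without contraction and weakening. - $\mathsf{AR}$ is the additive fragment of the relevant logic $\mathsf R$, in the same language as $\mathsf{ALL}$. Here $\mathsf R$ is the Hilbert system of multiplicative-additive linear logic together with the contraction axiom $(A\multimap(A\multimap B))\multimap(A\multimap B)$ and distributivity of $\&$ and $\oplus$. Deductions are from multisets of hypotheses: the leaves are assumptions $A\vdash A$ or axioms $\vdash B$, and the rules are: from $\Gamma\vdash A$ and $\Gamma'\vdash A\multimap B$ infer $\Gamma,\Gamma'\vdash B$; from $\Gamma\vdash A$ and $\Gamma\vdash B$ infer $\Gamma\vdash A\,\&\,B$. A multiset $J$ is *inconsistent* in $L$ if $J\vdash_L\emptyset$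 (for $\mathsf{AR}$: $J\vdash_{\mathsf R}\bot$, with $\bot$ the multiplicative falsum), *consistent* otherwise, and *robustly consistent* if $J$ and all its proper submultisets are consistent; for sets, subsets are meant. *Agendas and judgments.* Let $\sim\neg\psi=\psi$, and $\sim\varphi=\neg\varphi$ if $\varphi$ is not a negation. An agenda $\Phi$ of $\mathsf{CL}$ is a finite set of classical formulas closed under $\sim$ that contains no tautology and no contradiction. A judgment set is a robustly consistent (in $\mathsf{CL}$) subset $J\subseteq\Phi$; it is complete if for all $\varphi\in\Phi$, $\varphi\in J$ or $\sim\varphi\in J$. The collective agenda $\Phi'$ consists of the formulas of $\Phi$ with $\wedge,\vee,\to$ rewritten as $\&,\oplus,\leadsto$, regarded as a multiset with multiplicities one; we identify $\varphi\in\Phi$ with its translation in $\Phi'$. The number $n\ge 3$ of individuals is odd. *Aggregation.* An aggregation procedure is a function $F$ from $n$-tuples $\mathbf J=(J_1,\dots,J_n)$ of complete judgment sets to submultisets of $\Phi'$. MAJ is the following class of properties: - weak rationality: every $F(\mathbf J)$ is complete with respect to $\Phi'$ and contains no formula together with its complement; - anonymity: $F(\mathbf J)$ is unchanged by permuting the individuals;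 - independence: if $\varphi\in J_i\Leftrightarrow\varphi\in J'_i$ for all $i$, then $\varphi\in F(\mathbf J)\Leftrightarrow\varphi\in F(\mathbf J')$; - neutrality: if $\varphi\in J_i\Leftrightarrow\psi\in J_i$ for all $i$, then $\varphi\in F(\mathbf J)\Leftrightarrow\psi\in F(\mathbf J)$; - monotonicity: if $\mathbf J$ and $\mathbf J'$ differ only at $i$, $\varphi\notin J_i$ and $\varphi\in J'_i$, then $\varphi\in F(\mathbf J)\Rightarrow\varphi\in F(\mathbf J')$. The pair $(\mathsf{CL},L')$ is *safe for MAJ* if for all such $n$ and $\Phi$, every aggregation procedure $F$ with the properties MAJ has only values $F(\mathbf J)$ that are robustly consistent in $L'$. **Corollary 41.** The pairs $(\mathsf{CL},\mathsf{ALL})$ and $(\mathsf{CL},\mathsf{AR})$ are safe for MAJ. Moreover, for every such $n$ and $\Phi$ and all (not necessarily complete) judgment sets $J_1,\dots,J_n$, the majority outcome $\{\varphi\in\Phi : |\{i:\varphi\in J_i\}|>n/2\}$, regarded as a multiset of formulas of $\Phi'$ with multiplicities one, is robustly consistent in $\mathsf{ALL}$ and in $\mathsf{AR}$. -/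

import Mathlib

namespace JA

universe u v

/-! ### Languages -/

/-- Formulas of classical propositional logic over the set `P` of variables. -/
inductive ClForm (P : Type u) : Type u where
  | var : P → ClForm P
  | neg : ClForm P → ClForm P
  | and : ClForm P → ClForm P → ClForm P
  | or : ClForm P → ClForm P → ClForm P
  | imp : ClForm P → ClForm P → ClForm P

/-- Formulas of the additive language: negation, additive conjunction `&` (`amp`), additive
disjunction `⊕` (`plus`), additive implication `⤳` (`aimp`), and no constants. -/
inductive AddForm (P : Type u) : Type u where
  | var : P → AddForm P
  | neg : AddForm P → AddForm P
  | amp : AddForm P → AddForm P → AddForm P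
  | plus : AddForm P → AddForm P → AddForm P
  | aimp : AddForm P → AddForm P → AddForm P

/-- Formulas of the full multiplicative-additive language. The constants are the multiplicative
units `one` (of `⊗`) and `bot` (of `⅋`), and the additive units `top` (of `&`) and `zero`
(of `⊕`); `lolli` is `⊸`. -/
inductive MallForm (P : Type u) : Type u where
  | var : P → MallForm P
  | one : MallForm P
  | bot : MallForm P
  | top : MallForm P
  | zero : MallForm P
  | neg : MallForm P → MallForm P
  | tensor : MallForm P → MallForm P → MallForm P
  | par : MallForm P → MallForm P → MallForm P
  | amp : MallForm P → MallForm P → MallForm P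
  | plus : MallForm P → MallForm P → MallForm P
  | lolli : MallForm P → MallForm P → MallForm P
  | aimp : MallForm P → MallForm P → MallForm P

/-- The complement of a classical formula: `∼¬ψ = ψ`, and `∼φ = ¬φ` if `φ` is not negated. -/
def ClForm.compl {P : Type u} : ClForm P → ClForm P
  | .neg A => A
  | A => .neg A

/-- The complement of an additive formula. -/
def AddForm.compl {P : Type u} : AddForm P → AddForm P
  | .neg A => A
  | A => .neg A

/-- The translation of the classical language into the additive language. -/
def ClForm.toAdd {P : Type u} : ClForm P → AddForm P
  | .var p => .var p
  | .neg A => .neg A.toAdd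
  | .and A B => .amp A.toAdd B.toAdd
  | .or A B => .plus A.toAdd B.toAdd
  | .imp A B => .aimp A.toAdd B.toAdd

/-- The inclusion of the additive language into the full language. -/
def AddForm.toMall {P : Type u} : AddForm P → MallForm P
  | .var p => .var p
  | .neg A => .neg A.toMall
  | .amp A B => .amp A.toMall B.toMall
  | .plus A B => .plus A.toMall B.toMall
  | .aimp A B => .aimp A.toMall B.toMall

/-! ### The sequent calculus of classical logic -/

/-- `ClProv Γ Δ`: the sequent `Γ ⊢ Δ` is provable in the classical sequent calculus. Sequents are
pairs of multisets (so exchange is built in); contraction and weakening are rules, and the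
connectives have both their multiplicative and their additive rules. -/
inductive ClProv {P : Type u} : Multiset (ClForm P) → Multiset (ClForm P) → Prop where
  | ax (A : ClForm P) : ClProv {A} {A}
  | cut {Γ Γ' Δ Δ'} (A : ClForm P) : ClProv (A ::ₘ Γ) Δ → ClProv Γ' (A ::ₘ Δ') → ClProv (Γ + Γ') (Δ + Δ')
  | contrL {Γ Δ} (A : ClForm P) : ClProv (A ::ₘ A ::ₘ Γ) Δ → ClProv (A ::ₘ Γ) Δ
  | contrR {Γ Δ} (A : ClForm P) : ClProv Γ (A ::ₘ A ::ₘ Δ) → ClProv Γ (A ::ₘ Δ)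
  | weakL {Γ Δ} (A : ClForm P) : ClProv Γ Δ → ClProv (A ::ₘ Γ) Δ
  | weakR {Γ Δ} (A : ClForm P) : ClProv Γ Δ → ClProv Γ (A ::ₘ Δ)
  | negL {Γ Δ} (A : ClForm P) : ClProv Γ (A ::ₘ Δ) → ClProv (A.neg ::ₘ Γ) Δ
  | negR {Γ Δ} (A : ClForm P) : ClProv (A ::ₘ Γ) Δ → ClProv Γ (A.neg ::ₘ Δ)
  | andRMul {Γ Γ' Δ Δ'} (A B : ClForm P) : ClProv Γ (A ::ₘ Δ) → ClProv Γ' (B ::ₘ Δ') →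
      ClProv (Γ + Γ') (A.and B ::ₘ (Δ + Δ'))
  | andLMul {Γ Δ} (A B : ClForm P) : ClProv (A ::ₘ B ::ₘ Γ) Δ → ClProv (A.and B ::ₘ Γ) Δ
  | orLMul {Γ Γ' Δ Δ'} (A B : ClForm P) : ClProv (A ::ₘ Γ) Δ → ClProv (B ::ₘ Γ') Δ' →
      ClProv (A.or B ::ₘ (Γ + Γ')) (Δ + Δ')
  | orRMul {Γ Δ} (A B : ClForm P) : ClProv Γ (A ::ₘ B ::ₘ Δ) → ClProv Γ (A.or B ::ₘ Δ)
  | impLMul {Γ Γ' Δ Δ'} (A B : ClForm P) : ClProv Γ (A ::ₘ Δ) → ClProv (B ::ₘ Γ') Δ' →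
      ClProv (A.imp B ::ₘ (Γ + Γ')) (Δ + Δ')
  | impRMul {Γ Δ} (A B : ClForm P) : ClProv (A ::ₘ Γ) (B ::ₘ Δ) → ClProv Γ (A.imp B ::ₘ Δ)
  | andRAdd {Γ Δ} (A B : ClForm P) : ClProv Γ (A ::ₘ Δ) → ClProv Γ (B ::ₘ Δ) → ClProv Γ (A.and B ::ₘ Δ)
  | andLAdd₁ {Γ Δ} (A B : ClForm P) : ClProv (A ::ₘ Γ) Δ → ClProv (A.and B ::ₘ Γ) Δ
  | andLAdd₂ {Γ Δ} (A B : ClForm P) : ClProv (B ::ₘ Γ) Δ → ClProv (A.and B ::ₘ Γ) Δ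
  | orLAdd {Γ Δ} (A B : ClForm P) : ClProv (A ::ₘ Γ) Δ → ClProv (B ::ₘ Γ) Δ → ClProv (A.or B ::ₘ Γ) Δ
  | orRAdd₁ {Γ Δ} (A B : ClForm P) : ClProv Γ (A ::ₘ Δ) → ClProv Γ (A.or B ::ₘ Δ)
  | orRAdd₂ {Γ Δ} (A B : ClForm P) : ClProv Γ (B ::ₘ Δ) → ClProv Γ (A.or B ::ₘ Δ)
  | impLAdd {Γ Δ} (A B : ClForm P) : ClProv Γ (A ::ₘ Δ) → ClProv (B ::ₘ Γ) Δ → ClProv (A.imp B ::ₘ Γ) Δ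
  | impRAdd₁ {Γ Δ} (A B : ClForm P) : ClProv (A ::ₘ Γ) Δ → ClProv Γ (A.imp B ::ₘ Δ)
  | impRAdd₂ {Γ Δ} (A B : ClForm P) : ClProv Γ (B ::ₘ Δ) → ClProv Γ (A.imp B ::ₘ Δ)

/-! ### The sequent calculus of additive linear logic -/

/-- `AllProv Γ Δ`: the sequent `Γ ⊢ Δ` is provable in additive linear logic, the additive fragment
of the calculus of multiplicative-additive linear logic (identities, negation, rules of the
additive connectives; no contraction, no weakening, no constants). -/
inductive AllProv {P : Type u} : Multiset (AddForm P) → Multiset (AddForm P) → Prop where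
  | ax (A : AddForm P) : AllProv {A} {A}
  | cut {Γ Γ' Δ Δ'} (A : AddForm P) : AllProv (A ::ₘ Γ) Δ → AllProv Γ' (A ::ₘ Δ') →
      AllProv (Γ + Γ') (Δ + Δ')
  | negL {Γ Δ} (A : AddForm P) : AllProv Γ (A ::ₘ Δ) → AllProv (A.neg ::ₘ Γ) Δ
  | negR {Γ Δ} (A : AddForm P) : AllProv (A ::ₘ Γ) Δ → AllProv Γ (A.neg ::ₘ Δ)
  | ampR {Γ Δ} (A B : AddForm P) : AllProv Γ (A ::ₘ Δ) → AllProv Γ (B ::ₘ Δ) → AllProv Γ (A.amp B ::ₘ Δ)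
  | ampL₁ {Γ Δ} (A B : AddForm P) : AllProv (A ::ₘ Γ) Δ → AllProv (A.amp B ::ₘ Γ) Δ
  | ampL₂ {Γ Δ} (A B : AddForm P) : AllProv (B ::ₘ Γ) Δ → AllProv (A.amp B ::ₘ Γ) Δ
  | plusL {Γ Δ} (A B : AddForm P) : AllProv (A ::ₘ Γ) Δ → AllProv (B ::ₘ Γ) Δ →
      AllProv (A.plus B ::ₘ Γ) Δ
  | plusR₁ {Γ Δ} (A B : AddForm P) : AllProv Γ (A ::ₘ Δ) → AllProv Γ (A.plus B ::ₘ Δ)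
  | plusR₂ {Γ Δ} (A B : AddForm P) : AllProv Γ (B ::ₘ Δ) → AllProv Γ (A.plus B ::ₘ Δ)
  | aimpL {Γ Δ} (A B : AddForm P) : AllProv Γ (A ::ₘ Δ) → AllProv (B ::ₘ Γ) Δ →
      AllProv (A.aimp B ::ₘ Γ) Δ
  | aimpR₁ {Γ Δ} (A B : AddForm P) : AllProv (A ::ₘ Γ) Δ → AllProv Γ (A.aimp B ::ₘ Δ)
  | aimpR₂ {Γ Δ} (A B : AddForm P) : AllProv Γ (B ::ₘ Δ) → AllProv Γ (A.aimp B ::ₘ Δ)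

/-! ### The Hilbert system of relevant logic -/

open MallForm in
/-- The logical postulates of the Hilbert system of the relevant logic `R`: those of
multiplicative-additive linear logic, contraction, and distributivity of the additives. -/
inductive RAx {P : Type u} : MallForm P → Prop where
  | id (A) : RAx (lolli A A)
  | comp (A B C) : RAx (lolli (lolli A B) (lolli (lolli B C) (lolli A C)))
  | perm (A B C) : RAx (lolli (lolli A (lolli B C)) (lolli B (lolli A C)))
  | dne (A) : RAx (lolli (neg (neg A)) A)
  | contrapos (A B) : RAx (lolli (lolli A B) (lolli (neg B) (neg A)))
  | tensorI (A B) : RAx (lolli A (lolli B (tensor A B)))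
  | tensorE (A B C) : RAx (lolli (lolli A (lolli B C)) (lolli (tensor A B) C))
  | oneI : RAx one
  | oneE (A) : RAx (lolli one (lolli A A))
  | botE : RAx (lolli bot (neg one))
  | botI : RAx (lolli (neg one) bot)
  | ampE₁ (A B) : RAx (lolli (amp A B) A)
  | ampE₂ (A B) : RAx (lolli (amp A B) B)
  | ampI (A B C) : RAx (lolli (amp (lolli A B) (lolli A C)) (lolli A (amp B C)))
  | plusI₁ (A B) : RAx (lolli A (plus A B))
  | plusI₂ (A B) : RAx (lolli B (plus A B))
  | ampDef₁ (A B) : RAx (lolli (amp A B) (neg (plus (neg A) (neg B))))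
  | ampDef₂ (A B) : RAx (lolli (neg (plus (neg A) (neg B))) (amp A B))
  | parDef₁ (A B) : RAx (lolli (par A B) (lolli (neg A) B))
  | parDef₂ (A B) : RAx (lolli (lolli (neg A) B) (par A B))
  | tensorDef₁ (A B) : RAx (lolli (tensor A B) (neg (par (neg A) (neg B))))
  | tensorDef₂ (A B) : RAx (lolli (neg (par (neg A) (neg B))) (tensor A B))
  | plusE (A B C) : RAx (lolli (amp (lolli A C) (lolli B C)) (lolli (plus A B) C))
  | topI (A) : RAx (lolli A top)
  | zeroE (A) : RAx (lolli zero A)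
  | aimpDef₁ (A B) : RAx (lolli (aimp A B) (plus (neg A) B))
  | aimpDef₂ (A B) : RAx (lolli (plus (neg A) B) (aimp A B))
  | contraction (A B) : RAx (lolli (lolli A (lolli A B)) (lolli A B))
  | distrib₁ (A B C) : RAx (lolli (amp A (plus B C)) (plus (amp A B) (amp A C)))
  | distrib₂ (A B C) : RAx (lolli (amp (plus A B) (plus A C)) (plus A (amp B C)))

/-- `RDeriv Γ A`: there is a deduction tree of `R` with conclusion `Γ ⊢ A`, where `Γ` is the
multiset of the open assumptions. -/
inductive RDeriv {P : Type u} : Multiset (MallForm P) → MallForm P → Prop where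
  | assumption (A) : RDeriv {A} A
  | ofAx {A} : RAx A → RDeriv 0 A
  | lolliRule {Γ Γ' A B} : RDeriv Γ A → RDeriv Γ' (.lolli A B) → RDeriv (Γ + Γ') B
  | ampRule {Γ A B} : RDeriv Γ A → RDeriv Γ B → RDeriv Γ (.amp A B)

/-! ### The three logics, as seen by judgment aggregation -/

/-- The data of a logic that judgment aggregation uses: complements, which formulas are theorems
(`⊢ φ`), and which multisets of formulas are inconsistent (`J ⊢ ∅`). Only the three concrete logics
below are used. -/
structure Logic (Form : Type u) where
  compl : Form → Form
  Thm : Form → Prop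
  Incons : Multiset Form → Prop

/-- Classical logic. -/
def CL (P : Type u) : Logic (ClForm P) where
  compl := ClForm.compl
  Thm φ := ClProv 0 {φ}
  Incons J := ClProv J 0

/-- Additive linear logic. -/
def ALL (P : Type u) : Logic (AddForm P) where
  compl := AddForm.compl
  Thm φ := AllProv 0 {φ}
  Incons J := AllProv J 0

/-- The additive fragment of relevant logic: derivability in `R` between formulas of the additive
language. In a Hilbert system, `J ⊢ ∅` is `J ⊢ ⊥`. -/
def AR (P : Type u) : Logic (AddForm P) where
  compl := AddForm.compl
  Thm φ := RDeriv 0 φ.toMall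
  Incons J := RDeriv (J.map AddForm.toMall) .bot

/-! ### Judgments -/

section Judgments

variable {Form : Type u}

/-- A multiset is consistent if it does not entail the empty conclusion. -/
def Consistent (L : Logic Form) (J : Multiset Form) : Prop := ¬ L.Incons J

/-- Robust consistency: consistent, and so is every proper submultiset. For the multiset underlying
a finite set, the submultisets are the subsets. -/
def RobustlyConsistent (L : Logic Form) (J : Multiset Form) : Prop :=
  Consistent L J ∧ ∀ J' < J, Consistent L J'

/-- `J` is complete with respect to the agenda `Φ`. -/
def Complete (L : Logic Form) (Φ J : Multiset Form) : Prop :=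
  ∀ φ ∈ Φ, φ ∈ J ∨ L.compl φ ∈ J

/-- `J` does not contain both a formula and its complement. -/
def ComplementFree (L : Logic Form) (J : Multiset Form) : Prop :=
  ∀ φ, ¬ (φ ∈ J ∧ L.compl φ ∈ J)

/-- An agenda: a finite set of formulas, closed under complements, without tautologies and without
contradictions. -/
structure Agenda (L : Logic Form) where
  carrier : Finset Form
  compl_mem : ∀ φ ∈ carrier, L.compl φ ∈ carrier
  not_thm : ∀ φ ∈ carrier, ¬ L.Thm φ
  not_contradiction : ∀ φ ∈ carrier, ¬ L.Incons {φ}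

/-- Individual judgment sets: robustly consistent subsets of the agenda. -/
def IsJudgment {L : Logic Form} (Φ : Agenda L) (J : Finset Form) : Prop :=
  J ⊆ Φ.carrier ∧ RobustlyConsistent L J.val

/-- Complete individual judgment sets. -/
def IsCompleteJudgment {L : Logic Form} (Φ : Agenda L) (J : Finset Form) : Prop :=
  IsJudgment Φ J ∧ Complete L Φ.carrier.val J.val

/-- Profiles of complete judgment sets of `n` individuals. -/
abbrev Profile {L : Logic Form} (Φ : Agenda L) (n : ℕ) : Type u :=
  Fin n → {J : Finset Form // IsCompleteJudgment Φ J}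

end Judgments

/-! ### Aggregation from the agenda of one logic to that of another -/

section Aggregation

variable {Form : Type u} {Form' : Type v} {L : Logic Form} {n : ℕ}

/-- The collective agenda: the translated formulas of the individual agenda, as a multiset (with
multiplicity one when the translation is injective). -/
def Agenda.translate (Φ : Agenda L) (tr : Form → Form') : Multiset Form' :=
  Φ.carrier.val.map tr

/-- Aggregation procedures: functions from profiles of complete judgment sets to the multisets
included in the collective agenda. -/
abbrev Aggregator (Φ : Agenda L) (n : ℕ) (tr : Form → Form') : Type (max u v) :=
  Profile Φ n → {K : Multiset Form' // K ≤ Φ.translate tr}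

variable {Φ : Agenda L} {tr : Form → Form'}

/-- Weak rationality, with respect to the collective logic. -/
def WeaklyRational (L' : Logic Form') (F : Aggregator Φ n tr) : Prop :=
  ∀ J, Complete L' (Φ.translate tr) (F J).1 ∧ ComplementFree L' (F J).1

/-- Anonymity. -/
def Anonymous (F : Aggregator Φ n tr) : Prop :=
  ∀ (J : Profile Φ n) (σ : Equiv.Perm (Fin n)), F (fun i => J (σ i)) = F J

/-- Neutrality. -/
def Neutral (F : Aggregator Φ n tr) : Prop :=
  ∀ φ ∈ Φ.carrier, ∀ ψ ∈ Φ.carrier, ∀ J : Profile Φ n,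
    (∀ i, φ ∈ (J i).1 ↔ ψ ∈ (J i).1) → (tr φ ∈ (F J).1 ↔ tr ψ ∈ (F J).1)

/-- Independence. -/
def Independent (F : Aggregator Φ n tr) : Prop :=
  ∀ φ ∈ Φ.carrier, ∀ J J' : Profile Φ n,
    (∀ i, φ ∈ (J i).1 ↔ φ ∈ (J' i).1) → (tr φ ∈ (F J).1 ↔ tr φ ∈ (F J').1)

/-- Monotonicity: `J` and `J'` differ at most in the judgment set of the individual `i`. -/
def Monotonic (F : Aggregator Φ n tr) : Prop :=
  ∀ φ ∈ Φ.carrier, ∀ (J J' : Profile Φ n) (i : Fin n), (∀ j, j ≠ i → J j = J' j) →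
    φ ∉ (J i).1 → φ ∈ (J' i).1 → tr φ ∈ (F J).1 → tr φ ∈ (F J').1

/-- The class MAJ of properties that goes with the majority rule: weak rationality, anonymity,
independence, neutrality and monotonicity. -/
def MAJ (L' : Logic Form') (F : Aggregator Φ n tr) : Prop :=
  WeaklyRational L' F ∧ Anonymous F ∧ Independent F ∧ Neutral F ∧ Monotonic F

open Classical in
/-- The majority outcome: the multiset (with multiplicity one) of the translations of those formulas
of the agenda that more than half of the individuals accept. -/
noncomputable def majority (Φ : Agenda L) (tr : Form → Form') (J : Fin n → Finset Form) :
    Multiset Form' :=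
  (Φ.carrier.filter fun φ => n < 2 * Nat.card {i : Fin n // φ ∈ J i}).val.map tr

end Aggregation

/-- The pair of logics `(L, L')`, with the translation `tr` of the language of `L` into that of
`L'`, is safe for MAJ: for every odd number `n ≥ 3` of individuals and every agenda of `L`, every
aggregation procedure in the class returns multisets that are robustly consistent in `L'`. -/
def SafeForMAJ {Form : Type u} {Form' : Type v} (L : Logic Form) (L' : Logic Form')
    (tr : Form → Form') : Prop :=
  ∀ n : ℕ, Odd n → 3 ≤ n → ∀ (Φ : Agenda L) (F : Aggregator Φ n tr),
    MAJ L' F → ∀ J : Profile Φ n, RobustlyConsistent L' (F J).1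

end JA

namespace JA

universe u v

/-! ### Classical semantics -/

/-! Both target logics are classically sound, and both can refute only small multisets of additive
formulas. In additive linear logic every provable sequent has exactly two formulas
(`AllProv.card_add_card`). In relevant logic a five-element De Morgan monoid shows that three or
more additive formulas never yield `⊥` (`RDeriv.card_le_two`). So an inconsistent submultiset of an
outcome would contain two, possibly equal, formulas with no common classical model.

It remains to see that accepted formulas are pairwise satisfiable. For majority, two majorities
share an individual, whose judgment set has a model by completeness of the classical calculus. For a
procedure in MAJ, accepting jointly unsatisfiable `A` and `B` would force acceptance of the
complement of `B` (`MAJ.exists_model_pair`). -/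

def ClForm.Holds {P : Type u} (v : P → Prop) : ClForm P → Prop
  | .var p => v p
  | .neg A => ¬ A.Holds v
  | .and A B => A.Holds v ∧ B.Holds v
  | .or A B => A.Holds v ∨ B.Holds v
  | .imp A B => A.Holds v → B.Holds v

def AddForm.Holds {P : Type u} (v : P → Prop) : AddForm P → Prop
  | .var p => v p
  | .neg A => ¬ A.Holds v
  | .amp A B => A.Holds v ∧ B.Holds v
  | .plus A B => A.Holds v ∨ B.Holds v
  | .aimp A B => A.Holds v → B.Holds v

def MallForm.Holds {P : Type u} (v : P → Prop) : MallForm P → Prop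
  | .var p => v p
  | .one => True
  | .bot => False
  | .top => True
  | .zero => False
  | .neg A => ¬ A.Holds v
  | .tensor A B => A.Holds v ∧ B.Holds v
  | .par A B => A.Holds v ∨ B.Holds v
  | .amp A B => A.Holds v ∧ B.Holds v
  | .plus A B => A.Holds v ∨ B.Holds v
  | .lolli A B => A.Holds v → B.Holds v
  | .aimp A B => A.Holds v → B.Holds v

section Semantics

variable {P : Type u}

theorem ClForm.holds_compl (v : P → Prop) (A : ClForm P) : A.compl.Holds v ↔ ¬ A.Holds v := by
  cases A <;> simp [ClForm.compl, ClForm.Holds]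

theorem ClForm.toAdd_compl (A : ClForm P) : A.compl.toAdd = A.toAdd.compl := by
  cases A <;> simp [ClForm.compl, ClForm.toAdd, AddForm.compl]

theorem ClForm.holds_toAdd (v : P → Prop) (A : ClForm P) : A.toAdd.Holds v ↔ A.Holds v := by
  induction A <;> simp_all [ClForm.toAdd, ClForm.Holds, AddForm.Holds]

theorem AddForm.holds_toMall (v : P → Prop) (A : AddForm P) : A.toMall.Holds v ↔ A.Holds v := by
  induction A <;> simp_all [AddForm.toMall, MallForm.Holds, AddForm.Holds]

theorem ClProv.sound {Γ Δ : Multiset (ClForm P)} (h : ClProv Γ Δ) (v : P → Prop)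
    (hΓ : ∀ A ∈ Γ, A.Holds v) : ∃ A ∈ Δ, A.Holds v := by
  induction h <;>
    simp only [Multiset.mem_cons, Multiset.mem_add, Multiset.mem_singleton, forall_eq,
      exists_eq_left, ClForm.Holds, or_imp, forall_and, or_and_right, exists_or] at * <;>
    grind

theorem AllProv.sound {Γ Δ : Multiset (AddForm P)} (h : AllProv Γ Δ) (v : P → Prop)
    (hΓ : ∀ A ∈ Γ, A.Holds v) : ∃ A ∈ Δ, A.Holds v := by
  induction h <;>
    simp only [Multiset.mem_cons, Multiset.mem_add, Multiset.mem_singleton, forall_eq,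
      exists_eq_left, AddForm.Holds, or_imp, forall_and, or_and_right, exists_or] at * <;>
    grind

theorem RAx.holds {A : MallForm P} (h : RAx A) (v : P → Prop) : A.Holds v := by
  cases h <;> simp only [MallForm.Holds] <;> tauto

theorem RDeriv.sound {Γ : Multiset (MallForm P)} {A : MallForm P} (h : RDeriv Γ A) (v : P → Prop)
    (hΓ : ∀ B ∈ Γ, B.Holds v) : A.Holds v := by
  induction h with
  | assumption A => exact hΓ A (by simp)
  | ofAx h => exact h.holds v
  | lolliRule _ _ ih₁ ih₂ =>
    exact ih₂ (fun B hB => hΓ B (Multiset.mem_add.2 (.inr hB)))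
      (ih₁ fun B hB => hΓ B (Multiset.mem_add.2 (.inl hB)))
  | ampRule _ _ ih₁ ih₂ => exact ⟨ih₁ hΓ, ih₂ hΓ⟩

/-! ### Completeness of the classical sequent calculus -/

def ClForm.size : ClForm P → ℕ
  | .var _ => 0
  | .neg A => A.size + 1
  | .and A B => A.size + B.size + 1
  | .or A B => A.size + B.size + 1
  | .imp A B => A.size + B.size + 1

theorem ClProv.weaken_add {Γ Δ : Multiset (ClForm P)} (h : ClProv Γ Δ)
    (Γ' Δ' : Multiset (ClForm P)) : ClProv (Γ' + Γ) (Δ' + Δ) := by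
  induction Γ' using Multiset.induction with
  | empty =>
    induction Δ' using Multiset.induction with
    | empty => simpa using h
    | cons A Δ' ih => rw [Multiset.cons_add]; exact .weakR A ih
  | cons A Γ' ih => rw [Multiset.cons_add]; exact .weakL A ih

theorem ClProv.of_mem_of_mem {Γ Δ : Multiset (ClForm P)} {A : ClForm P} (hΓ : A ∈ Γ)
    (hΔ : A ∈ Δ) : ClProv Γ Δ := by
  obtain ⟨Γ', rfl⟩ := Multiset.exists_cons_of_mem hΓ
  obtain ⟨Δ', rfl⟩ := Multiset.exists_cons_of_mem hΔ
  rw [← Multiset.singleton_add, ← Multiset.singleton_add, add_comm, add_comm {A} Δ']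
  exact (ClProv.ax A).weaken_add Γ' Δ'

/-- Induction on the number of connectives: each compound formula is decomposed by an invertible
rule, so validity passes to the premises. -/
theorem ClProv.complete (Γ Δ : Multiset (ClForm P))
    (h : ∀ v : P → Prop, (∀ A ∈ Γ, A.Holds v) → ∃ A ∈ Δ, A.Holds v) : ClProv Γ Δ := by
  induction hn : (Γ.map ClForm.size).sum + (Δ.map ClForm.size).sum using Nat.strong_induction_on
    generalizing Γ Δ with
  | _ n ih =>
  by_cases hL : ∃ A ∈ Γ, ∀ p, A ≠ .var p
  · obtain ⟨A, hA, hp⟩ := hL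
    obtain ⟨Γ, rfl⟩ := Multiset.exists_cons_of_mem hA
    cases A with
    | var p => exact absurd rfl (hp p)
    | neg A =>
      refine .negL A (ih _ ?_ _ _ (fun v => ?_) rfl)
      · simp [ClForm.size] at hn ⊢; omega
      · have := h v
        simp only [Multiset.mem_cons, forall_eq_or_imp, exists_eq_or_imp, ClForm.Holds] at this ⊢
        tauto
    | and A B =>
      refine .andLMul A B (ih _ ?_ _ _ (fun v => ?_) rfl)
      · simp [ClForm.size] at hn ⊢; omega
      · have := h v
        simp only [Multiset.mem_cons, forall_eq_or_imp, ClForm.Holds] at this ⊢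
        tauto
    | or A B =>
      refine .orLAdd A B (ih _ ?_ _ _ (fun v => ?_) rfl) (ih _ ?_ _ _ (fun v => ?_) rfl)
      any_goals (simp [ClForm.size] at hn ⊢; omega)
      all_goals
        have := h v
        simp only [Multiset.mem_cons, forall_eq_or_imp, ClForm.Holds] at this ⊢
        tauto
    | imp A B =>
      refine .impLAdd A B (ih _ ?_ _ _ (fun v => ?_) rfl) (ih _ ?_ _ _ (fun v => ?_) rfl)
      any_goals (simp [ClForm.size] at hn ⊢; omega)
      all_goals
        have := h v
        simp only [Multiset.mem_cons, forall_eq_or_imp, exists_eq_or_imp, ClForm.Holds] at this ⊢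
        tauto
  by_cases hR : ∃ A ∈ Δ, ∀ p, A ≠ .var p
  · obtain ⟨A, hA, hp⟩ := hR
    obtain ⟨Δ, rfl⟩ := Multiset.exists_cons_of_mem hA
    cases A with
    | var p => exact absurd rfl (hp p)
    | neg A =>
      refine .negR A (ih _ ?_ _ _ (fun v => ?_) rfl)
      · simp [ClForm.size] at hn ⊢; omega
      · have := h v
        simp only [Multiset.mem_cons, forall_eq_or_imp, exists_eq_or_imp, ClForm.Holds] at this ⊢
        tauto
    | and A B =>
      refine .andRAdd A B (ih _ ?_ _ _ (fun v => ?_) rfl) (ih _ ?_ _ _ (fun v => ?_) rfl)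
      any_goals (simp [ClForm.size] at hn ⊢; omega)
      all_goals
        have := h v
        simp only [Multiset.mem_cons, exists_eq_or_imp, ClForm.Holds] at this ⊢
        tauto
    | or A B =>
      refine .orRMul A B (ih _ ?_ _ _ (fun v => ?_) rfl)
      · simp [ClForm.size] at hn ⊢; omega
      · have := h v
        simp only [Multiset.mem_cons, exists_eq_or_imp, ClForm.Holds] at this ⊢
        tauto
    | imp A B =>
      refine .impRMul A B (ih _ ?_ _ _ (fun v => ?_) rfl)
      · simp [ClForm.size] at hn ⊢; omega
      · have := h v
        simp only [Multiset.mem_cons, forall_eq_or_imp, exists_eq_or_imp, ClForm.Holds] at this ⊢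
        tauto
  push Not at hL hR
  -- Only variables remain. The valuation true exactly on `Γ` forces `Γ` and `Δ` to share one.
  obtain ⟨A, hA, hv⟩ := h (fun p => .var p ∈ Γ) fun A hA => by
    obtain ⟨p, rfl⟩ := hL A hA
    exact hA
  obtain ⟨p, rfl⟩ := hR A hA
  exact .of_mem_of_mem hv hA

theorem CL.exists_model {J : Multiset (ClForm P)} (h : Consistent (CL P) J) :
    ∃ v : P → Prop, ∀ A ∈ J, A.Holds v := by
  by_contra! hv
  refine h (ClProv.complete J 0 fun v hJ => ?_)
  obtain ⟨A, hA, hn⟩ := hv v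
  exact absurd (hJ A hA) hn

theorem CL.consistent_of_model {J : Multiset (ClForm P)} (v : P → Prop)
    (h : ∀ A ∈ J, A.Holds v) : Consistent (CL P) J := fun hJ => by
  obtain ⟨A, hA, -⟩ := ClProv.sound hJ v h
  simp at hA

/-! ### Size of inconsistent multisets of additive formulas -/

/-- Without weakening and contraction, each one-premise or additive rule preserves the total, and
cut removes two formulas from a total of four. -/
theorem AllProv.card_add_card {Γ Δ : Multiset (AddForm P)} (h : AllProv Γ Δ) :
    Γ.card + Δ.card = 2 := by
  induction h <;> simp only [Multiset.card_cons, Multiset.card_add, Multiset.card_singleton] at *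
    <;> omega

/-- The product of a five-element De Morgan monoid: truncated addition of the exponents `0, …, 3`
(represented by `1, …, 4`), with an absorbing least element `0`. -/
def chainMul (x y : Fin 5) : Fin 5 :=
  if x = 0 ∨ y = 0 then 0 else ⟨min 4 (x.1 + y.1 - 1), by omega⟩

/-- The residual of `chainMul`, obtained as `¬(x · ¬y)`; negation is `Fin.rev`. -/
def chainImp (x y : Fin 5) : Fin 5 := (chainMul x y.rev).rev

/-- The value of a formula in the five-element De Morgan monoid, all variables being sent to the
fixed point of negation. -/
def MallForm.chainVal : MallForm P → Fin 5
  | .var _ => 2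
  | .one => 1
  | .bot => 3
  | .top => 4
  | .zero => 0
  | .neg A => A.chainVal.rev
  | .tensor A B => chainMul A.chainVal B.chainVal
  | .par A B => chainImp A.chainVal.rev B.chainVal
  | .amp A B => min A.chainVal B.chainVal
  | .plus A B => max A.chainVal B.chainVal
  | .lolli A B => chainImp A.chainVal B.chainVal
  | .aimp A B => max A.chainVal.rev B.chainVal

instance : Std.Commutative chainMul := ⟨by decide⟩

instance : Std.Associative chainMul := ⟨by decide⟩

theorem chainMul_one (x : Fin 5) : chainMul x 1 = x := by revert x; decide

theorem chainMul_le_of_le_chainImp : ∀ a b x y : Fin 5, x ≤ a → y ≤ chainImp a b →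
    chainMul x y ≤ b := by decide

/-- A finite check. Contraction survives because `x ≤ x · x`, distributivity because the order is a
chain. -/
theorem RAx.one_le_chainVal {A : MallForm P} (h : RAx A) : 1 ≤ A.chainVal := by
  cases h <;> simp only [MallForm.chainVal] <;>
    first
    | decide
    | (generalize MallForm.chainVal _ = x; revert x; decide)
    | (generalize MallForm.chainVal _ = x; generalize MallForm.chainVal _ = y
       revert x y; decide)
    | (generalize MallForm.chainVal _ = x; generalize MallForm.chainVal _ = y
       generalize MallForm.chainVal _ = z
       revert x y z; decide)

/-- Open assumptions are combined by the monoid product: modus ponens is residuation, and adjunction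
is the universal property of `min`. -/
theorem RDeriv.fold_le_chainVal {Γ : Multiset (MallForm P)} {A : MallForm P} (h : RDeriv Γ A) :
    (Γ.map MallForm.chainVal).fold chainMul 1 ≤ A.chainVal := by
  induction h with
  | assumption A => rw [Multiset.map_singleton, Multiset.fold_singleton, chainMul_one]
  | ofAx h => simpa using h.one_le_chainVal
  | lolliRule _ _ ih₁ ih₂ =>
    have := chainMul_le_of_le_chainImp _ _ _ _ ih₁ ih₂
    rwa [← Multiset.fold_add chainMul, ← Multiset.map_add, chainMul_one] at this
  | ampRule _ _ ih₁ ih₂ => exact le_min ih₁ ih₂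

/-- The value `2` is fixed by `Fin.rev`, and `min` and `max` are idempotent. -/
theorem AddForm.chainVal_toMall (A : AddForm P) : A.toMall.chainVal = 2 := by
  induction A <;> simp_all [AddForm.toMall, MallForm.chainVal]

/-- Every assumption has value `2`, and `2 · 2 · 2 = 4` exceeds the value `3` of `⊥`. -/
theorem RDeriv.card_le_two {J : Multiset (AddForm P)} (h : RDeriv (J.map AddForm.toMall) .bot) :
    J.card ≤ 2 := by
  have h := h.fold_le_chainVal
  have hJ : (J.map AddForm.toMall).map MallForm.chainVal = Multiset.replicate J.card 2 := by
    simp [AddForm.chainVal_toMall]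
  rw [hJ] at h
  by_contra! hc
  obtain ⟨k, hk⟩ := Nat.exists_eq_add_of_le' (show 3 ≤ J.card from hc)
  rw [hk] at h
  have key : ∀ k, (Multiset.replicate (k + 3) (2 : Fin 5)).fold chainMul 1 = 4 := by
    intro k
    induction k with
    | zero => decide
    | succ k ih =>
      rw [Nat.add_right_comm, Multiset.replicate_succ, Multiset.fold_cons_left, ih]
      decide
  rw [key] at h
  exact absurd h (by simp only [MallForm.chainVal]; decide)

/-! ### From pairwise satisfiability to robust consistency -/

theorem exists_unsatisfiable_pair {J : Multiset (AddForm P)} (hc : J.card ≤ 2)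
    (hJ : ∀ v : P → Prop, ¬ ∀ A ∈ J, A.Holds v) :
    ∃ A ∈ J, ∃ B ∈ J, ∀ v : P → Prop, ¬ (A.Holds v ∧ B.Holds v) := by
  interval_cases h : J.card
  · rw [Multiset.card_eq_zero] at h
    subst h
    exact absurd (by simp) (hJ fun _ => True)
  · obtain ⟨A, rfl⟩ := Multiset.card_eq_one.1 h
    -- A single unsatisfiable formula is paired with itself.
    exact ⟨A, by simp, A, by simp, by simpa using hJ⟩
  · obtain ⟨A, B, rfl⟩ := Multiset.card_eq_two.1 h
    exact ⟨A, by simp, B, by simp, by simpa using hJ⟩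

theorem robustlyConsistent_of_incons {Form : Type u} {L : Logic Form} {J : Multiset Form}
    (h : ∀ J' ≤ J, ¬ L.Incons J') : RobustlyConsistent L J :=
  ⟨h J le_rfl, fun J' hJ' => h J' hJ'.le⟩

theorem ALL.robustlyConsistent {J : Multiset (AddForm P)}
    (h : ∀ A ∈ J, ∀ B ∈ J, ∃ v : P → Prop, A.Holds v ∧ B.Holds v) :
    RobustlyConsistent (ALL P) J := by
  refine robustlyConsistent_of_incons fun J' hJ' (hI : AllProv J' 0) => ?_
  obtain ⟨A, hA, B, hB, hAB⟩ := exists_unsatisfiable_pair (J := J')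
    (by have := hI.card_add_card; simp at this; omega)
    fun v hv => by simpa using hI.sound v hv
  obtain ⟨v, hv⟩ := h A (Multiset.mem_of_le hJ' hA) B (Multiset.mem_of_le hJ' hB)
  exact hAB v hv

theorem AR.robustlyConsistent {J : Multiset (AddForm P)}
    (h : ∀ A ∈ J, ∀ B ∈ J, ∃ v : P → Prop, A.Holds v ∧ B.Holds v) :
    RobustlyConsistent (AR P) J := by
  refine robustlyConsistent_of_incons fun J' hJ' (hI : RDeriv (J'.map AddForm.toMall) .bot) => ?_
  obtain ⟨A, hA, B, hB, hAB⟩ := exists_unsatisfiable_pair (J := J') hI.card_le_two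
    fun v hv => hI.sound v fun C hC => by
      obtain ⟨D, hD, rfl⟩ := Multiset.mem_map.1 hC
      exact (D.holds_toMall v).2 (hv D hD)
  obtain ⟨v, hv⟩ := h A (Multiset.mem_of_le hJ' hA) B (Multiset.mem_of_le hJ' hB)
  exact hAB v hv

end Semantics

/-! ### Aggregation -/

section Aggregation

/-- If every supporter of `φ` in `J` also supports `φ` in `J'`, then `φ` passes from the outcome of
`J` to that of `J'`. -/
theorem mem_of_support_subset {Form : Type u} {Form' : Type v} {L : Logic Form} {n : ℕ}
    {Φ : Agenda L} {tr : Form → Form'} {F : Aggregator Φ n tr} (hI : Independent F)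
    (hM : Monotonic F) {φ : Form} (hφ : φ ∈ Φ.carrier) {J J' : Profile Φ n}
    (hJ : ∀ i, φ ∈ (J i).1 → φ ∈ (J' i).1) (h : tr φ ∈ (F J).1) : tr φ ∈ (F J').1 := by
  classical
  -- Hybrid profiles pass from `J` to `J'` one individual at a time.
  have key : ∀ S : Finset (Fin n), tr φ ∈ (F fun i => if i ∈ S then J' i else J i).1 := by
    intro S
    induction S using Finset.induction_on with
    | empty => simpa using h
    | insert i S hi ih =>
      by_cases hc : φ ∉ (J i).1 ∧ φ ∈ (J' i).1
      · refine hM φ hφ _ _ i (fun j hj => ?_) ?_ ?_ ih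
        · simp [hj]
        · simpa [hi] using hc.1
        · simpa using hc.2
      -- By `hJ`, `i` does not drop `φ`, so here `i`'s verdict on `φ` is unchanged and independence
      -- suffices.
      · refine (hI φ hφ _ _ fun j => ?_).1 ih
        have := hJ i
        by_cases hj : j = i
        · subst hj; simp only [hi, if_false, Finset.mem_insert_self, if_true]; tauto
        · simp [hj]
  simpa using key Finset.univ

variable {P : Type u}

theorem CL.exists_isCompleteJudgment (Φ : Agenda (CL P)) (v : P → Prop) :
    ∃ J, IsCompleteJudgment Φ J ∧ ∀ A, A ∈ J ↔ A ∈ Φ.carrier ∧ A.Holds v := by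
  classical
  refine ⟨Φ.carrier.filter (·.Holds v), ⟨⟨Finset.filter_subset _ _, ?_⟩, ?_⟩, by simp⟩
  · exact robustlyConsistent_of_incons fun J' hJ' => CL.consistent_of_model v fun A hA =>
      (Finset.mem_filter.1 (Multiset.mem_of_le hJ' hA)).2
  · intro A hA
    simp only [Finset.mem_val, Finset.mem_filter]
    by_cases h : A.Holds v
    · exact .inl ⟨hA, h⟩
    · exact .inr ⟨Φ.compl_mem A hA, (A.holds_compl v).2 h⟩

/-- If `A` excludes `B`, the supporters of `A` all support the complement of `B`. Neutrality
compares formulas with equal support only, so the profile is first changed until these two supports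
coincide; monotonicity then leads back to `J`. -/
theorem MAJ.exists_model_pair {n : ℕ} {Φ : Agenda (CL P)} {L' : Logic (AddForm P)}
    (hL' : L'.compl = AddForm.compl) {F : Aggregator Φ n ClForm.toAdd} (hF : MAJ L' F)
    (J : Profile Φ n) {A B : AddForm P} (hA : A ∈ (F J).1) (hB : B ∈ (F J).1) :
    ∃ v : P → Prop, A.Holds v ∧ B.Holds v := by
  classical
  obtain ⟨hW, -, hI, hN, hM⟩ := hF
  obtain ⟨A, hAΦ, rfl⟩ := Multiset.mem_map.1 (Multiset.mem_of_le (F J).2 hA)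
  obtain ⟨B, hBΦ, rfl⟩ := Multiset.mem_map.1 (Multiset.mem_of_le (F J).2 hB)
  rw [Finset.mem_val] at hAΦ hBΦ
  simp only [ClForm.holds_toAdd]
  by_contra! hAB
  have hcΦ : B.compl ∈ Φ.carrier := Φ.compl_mem B hBΦ
  -- A model of `B` gives a complete judgment set `U` that rejects both `A` and the complement of
  -- `B`.
  obtain ⟨v, hv⟩ := CL.exists_model (Φ.not_contradiction B hBΦ)
  obtain ⟨U, hU, hmem⟩ := CL.exists_isCompleteJudgment Φ v
  have hvB : B.Holds v := hv B (by simp)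
  have hUA : A ∉ U := fun h => hAB v ((hmem A).1 h).2 hvB
  have hUB : B.compl ∉ U := fun h => (B.holds_compl v).1 ((hmem _).1 h).2 hvB
  have hJB : ∀ i, A ∈ (J i).1 → B.compl ∈ (J i).1 := by
    intro i hi
    obtain ⟨w, hw⟩ := CL.exists_model (J i).2.1.2.1
    exact ((J i).2.2 B hBΦ).resolve_left fun h => hAB w (hw A hi) (hw B h)
  -- Replacing the opponents of `A` by `U` keeps the support of `A` and shrinks that of the
  -- complement of `B` to it.
  let K : Profile Φ n := fun i => if A ∈ (J i).1 then J i else ⟨U, hU⟩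
  have hK : ∀ i, (A ∈ (K i).1 ↔ A ∈ (J i).1) ∧ (B.compl ∈ (K i).1 ↔ A ∈ (J i).1) := by
    intro i
    by_cases h : A ∈ (J i).1
    · simp [K, h, hJB i h]
    · simp [K, h, hUA, hUB]
  have h₁ : A.toAdd ∈ (F K).1 := (hI A hAΦ K J fun i => (hK i).1).2 hA
  have h₂ : B.compl.toAdd ∈ (F K).1 :=
    (hN A hAΦ _ hcΦ K fun i => (hK i).1.trans (hK i).2.symm).1 h₁
  have h₃ : B.compl.toAdd ∈ (F J).1 :=
    mem_of_support_subset hI hM hcΦ (fun i hi => hJB i ((hK i).2.1 hi)) h₂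
  exact (hW J).2 _ ⟨hB, by rwa [hL', ← ClForm.toAdd_compl]⟩

/-- Two strict majorities overlap, and a common member's judgment set is classically satisfiable. -/
theorem majority_exists_model_pair {n : ℕ} {Φ : Agenda (CL P)} {J : Fin n → Finset (ClForm P)}
    (hJ : ∀ i, IsJudgment Φ (J i)) {A B : AddForm P} (hA : A ∈ majority Φ ClForm.toAdd J)
    (hB : B ∈ majority Φ ClForm.toAdd J) : ∃ v : P → Prop, A.Holds v ∧ B.Holds v := by
  classical
  obtain ⟨A, hmA, rfl⟩ := Multiset.mem_map.1 hA
  obtain ⟨B, hmB, rfl⟩ := Multiset.mem_map.1 hB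
  have hA := (Finset.mem_filter.1 hmA).2
  have hB := (Finset.mem_filter.1 hmB).2
  simp only [ClForm.holds_toAdd]
  obtain ⟨i, hi⟩ : ∃ i, A ∈ J i ∧ B ∈ J i := by
    by_contra! h
    rw [Nat.card_eq_fintype_card, Fintype.card_subtype] at hA hB
    have hd : Disjoint (Finset.univ.filter fun i => A ∈ J i)
        (Finset.univ.filter fun i => B ∈ J i) :=
      Finset.disjoint_filter.2 fun i _ hi => h i hi
    have := Finset.card_le_univ ((Finset.univ.filter fun i => A ∈ J i) ∪
      (Finset.univ.filter fun i => B ∈ J i))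
    rw [Finset.card_union_of_disjoint hd, Fintype.card_fin] at this
    omega
  obtain ⟨v, hv⟩ := CL.exists_model (hJ i).2.1
  exact ⟨v, hv A hi.1, hv B hi.2⟩

end Aggregation

end JA

theorem corollary41 (P : Type*) :
    (JA.SafeForMAJ (JA.CL P) (JA.ALL P) JA.ClForm.toAdd ∧
      JA.SafeForMAJ (JA.CL P) (JA.AR P) JA.ClForm.toAdd) ∧
    (∀ n : ℕ, Odd n → 3 ≤ n →
      ∀ (Φ : JA.Agenda (JA.CL P)) (J : Fin n → Finset (JA.ClForm P)),
        (∀ i, JA.IsJudgment Φ (J i)) →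
          JA.RobustlyConsistent (JA.ALL P) (JA.majority Φ JA.ClForm.toAdd J) ∧
          JA.RobustlyConsistent (JA.AR P) (JA.majority Φ JA.ClForm.toAdd J)) := by
  refine ⟨⟨fun n _ _ Φ F hF J => ?_, fun n _ _ Φ F hF J => ?_⟩, fun n _ _ Φ J hJ => ⟨?_, ?_⟩⟩
  · exact JA.ALL.robustlyConsistent fun A hA B hB => JA.MAJ.exists_model_pair rfl hF J hA hB
  · exact JA.AR.robustlyConsistent fun A hA B hB => JA.MAJ.exists_model_pair rfl hF J hA hB
  · exact JA.ALL.robustlyConsistent fun A hA B hB => JA.majority_exists_model_pair hJ hA hB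
  · exact JA.AR.robustlyConsistent fun A hA B hB => JA.majority_exists_model_pair hJ hA hB
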